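/- Let $N\ge 3$, let $\mathcal D^{1,2}(\mathbb R^N)$ be the closure of $C_c^\infty(\mathbb R^N)$ with respect to the norm $\|\nabla u\|_{L^2(\mathbb R^N)}$ (realized, through the Sobolev inequality, as a space of functions in $L^{2N/(N-2)}(\mathbb R^N)$), and let $$\mathcal X:=\mathcal D^{1,2}(\mathbb R^N)\cap\{u\in C^{0,1}(\mathbb R^N)\,:\,\|\nabla u\|_{L^\infty(\mathbb R^N)}\le 1\}.$$ Then there exists a constant $C=C(N)>0$ such that $$\|\nabla u\|^2_{L^2(\mathbb R^N)}\ge C\,\|u\|^N_{L^\infty(\mathbb R^N)}\qquad\text{for all }u\in\mathcal X.$$ Moreover, the best constant $$\bar C:=\inf_{u\in\mathcal X\setminus\{0\}}\frac{\|\nabla u\|^2_{L^2(\mathbb R^N)}}{\|u\|^N_{L^\infty(\mathbb R^N)}}$$ is achieved by some $u\in\mathcal X\setminus\{0\}$ that is radial and radially decreasing, that is, $u(x)=f(|x|)$ for a strictly decreasing function $f$ on $[0,\infty)$. -/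

import Mathlib

open MeasureTheory Filter Topology
open scoped ENNReal ContDiff Gradient

noncomputable section

/-- Smooth compactly supported functions on `ℝ^N`. -/
def IsTestFunction {N : ℕ} (φ : EuclideanSpace ℝ (Fin N) → ℝ) : Prop :=
  ContDiff ℝ ∞ φ ∧ HasCompactSupport φ

/-- `G` is the weak (distributional) gradient of `u` on `ℝ^N`. -/
def HasWeakGradient {N : ℕ} (u : EuclideanSpace ℝ (Fin N) → ℝ)
    (G : EuclideanSpace ℝ (Fin N) → EuclideanSpace ℝ (Fin N)) : Prop :=
  LocallyIntegrable u volume ∧ LocallyIntegrable G volume ∧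
    ∀ φ : EuclideanSpace ℝ (Fin N) → ℝ, IsTestFunction φ →
      ∫ x, u x • ∇ φ x = - ∫ x, φ x • G x

/-- The critical Sobolev exponent `2* = 2N / (N - 2)`, meaningful for `N ≥ 3`. -/
def sobolevExponent (N : ℕ) : ℝ≥0∞ := ENNReal.ofReal (2 * (N : ℝ) / ((N : ℝ) - 2))

/-- Membership in `D^{1,2}(ℝ^N)`, `N ≥ 3`: the closure of the test functions in the norm
`‖∇u‖_{L²}`. As usual the abstract completion is realized as a space of functions by means of the
Sobolev embedding: the approximating test functions, which are Cauchy in `L^{2*}`, have `u` as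
their limit in `L^{2*}` (this excludes the non-zero constants, for which `‖∇u‖_{L²} = 0`). -/
def MemD12 {N : ℕ} (u : EuclideanSpace ℝ (Fin N) → ℝ) : Prop :=
  ∃ G : EuclideanSpace ℝ (Fin N) → EuclideanSpace ℝ (Fin N),
    HasWeakGradient u G ∧ MemLp G 2 volume ∧
    ∃ φ : ℕ → EuclideanSpace ℝ (Fin N) → ℝ,
      (∀ n, IsTestFunction (φ n)) ∧
      Tendsto (fun n => eLpNorm (fun x => ∇ (φ n) x - G x) 2 volume) atTop (𝓝 0) ∧
      Tendsto (fun n => eLpNorm (fun x => φ n x - u x) (sobolevExponent N) volume) atTop (𝓝 0)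

/-- The set `𝒳` of Lipschitz functions in `D^{1,2}(ℝ^N)` with `‖∇u‖_∞ ≤ 1`. A Lipschitz function
is differentiable almost everywhere, with `∇ u` as its weak gradient. -/
def spaceX (N : ℕ) : Set (EuclideanSpace ℝ (Fin N) → ℝ) :=
  {u | MemD12 u ∧ (∃ K, LipschitzWith K u) ∧ ∀ᵐ x, ‖∇ u x‖ ≤ 1}

/-- The quotient `‖∇u‖_{L²}² / ‖u‖_{L^∞}^N`. -/
def ratioR {N : ℕ} (u : EuclideanSpace ℝ (Fin N) → ℝ) : ℝ≥0∞ :=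
  eLpNorm (∇ u) 2 volume ^ 2 / eLpNorm u ∞ volume ^ N

/-- The best constant: the infimum of the quotient over `𝒳 \ {0}`. -/
def bestConstant (N : ℕ) : ℝ≥0∞ := ⨅ u ∈ spaceX N \ {0}, ratioR u

/-- `u` is radial and radially (strictly) decreasing. -/
def IsRadialDecreasing {N : ℕ} (u : EuclideanSpace ℝ (Fin N) → ℝ) : Prop :=
  ∃ f : ℝ → ℝ, StrictAntiOn f (Set.Ici 0) ∧ ∀ x, u x = f ‖x‖

end

/-! The minimiser is explicit, so neither compactness nor rearrangement is needed. Let `U = extremal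
N` be the cone `peak N - |x|` on the unit ball, continued by the harmonic tail `|x|^(2-N)/(N-2)`.
The two slopes agree at `|x| = 1`, so `-ΔU` has no surface part: weakly it is the nonnegative
function `w = (N-1)/|x|` on the unit ball and zero outside
(`integral_inner_extremalGradient_gradient`).

If `u` is 1-Lipschitz with `u 0 = peak N`, then `u ≥ U` on the unit ball, which carries `w`. Hence
`∫ ∇U·∇u = ∫ w u ≥ ∫ w U = ∫ |∇U|²`, and Cauchy–Schwarz gives `‖∇U‖₂ ≤ ‖∇u‖₂`
(`IsTestLimit.eLpNorm_extremalGradient_le`).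

For `u a > 0`, the rescaling `R⁻¹ u(a + R x)` with `R = u a / peak N` keeps the Lipschitz bound,
puts height `peak N` at the origin and divides the energy by `R^N`. So `(u a / peak N)^N ‖∇U‖₂² ≤
‖∇u‖₂²`; negative values follow by replacing `u` with `-u`. Taking the supremum over `a` yields the
inequality with constant `‖∇U‖₂² / (peak N)^N`, which `U` attains.

The remaining work is to place `U` in `𝒳` by truncation and mollification, and to extend the weak
equation from test functions to their limits. -/

open scoped Convolution NNReal RealInnerProductSpace
open ContinuousLinearMap (lsmul)

/-! ### Weak gradients, mollification and Lipschitz functions -/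

section WeakGradient

variable {N : ℕ} {u : EuclideanSpace ℝ (Fin N) → ℝ}
  {G G' : EuclideanSpace ℝ (Fin N) → EuclideanSpace ℝ (Fin N)} {φ : EuclideanSpace ℝ (Fin N) → ℝ}

theorem norm_gradient_eq (x : EuclideanSpace ℝ (Fin N)) : ‖∇ u x‖ = ‖fderiv ℝ u x‖ := by
  simp [gradient]

theorem LipschitzWith.norm_gradient_le {K : ℝ≥0} (hu : LipschitzWith K u)
    (x : EuclideanSpace ℝ (Fin N)) : ‖∇ u x‖ ≤ K := by
  rw [norm_gradient_eq]
  exact norm_fderiv_le_of_lipschitz ℝ hu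

theorem measurable_gradient : Measurable (∇ u) :=
  (InnerProductSpace.toDual ℝ _).symm.continuous.measurable.comp (measurable_fderiv ℝ u)

theorem IsTestFunction.continuous (hφ : IsTestFunction φ) : Continuous φ := hφ.1.continuous

theorem IsTestFunction.continuous_gradient (hφ : IsTestFunction φ) : Continuous (∇ φ) :=
  (InnerProductSpace.toDual ℝ _).symm.continuous.comp (hφ.1.continuous_fderiv (by simp))

theorem IsTestFunction.differentiable (hφ : IsTestFunction φ) : Differentiable ℝ φ :=
  hφ.1.differentiable (by simp)

theorem HasCompactSupport.gradient (hφ : HasCompactSupport φ) : HasCompactSupport (∇ φ) :=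
  (hφ.fderiv ℝ).comp_left (g := (InnerProductSpace.toDual ℝ _).symm) (by simp)

theorem IsTestFunction.memLp (hφ : IsTestFunction φ) (p : ℝ≥0∞) : MemLp φ p :=
  hφ.continuous.memLp_of_hasCompactSupport hφ.2

theorem IsTestFunction.memLp_gradient (hφ : IsTestFunction φ) (p : ℝ≥0∞) : MemLp (∇ φ) p :=
  hφ.continuous_gradient.memLp_of_hasCompactSupport hφ.2.gradient

theorem locallyIntegrable_of_norm_le {F : Type*} [NormedAddCommGroup F]
    {g : EuclideanSpace ℝ (Fin N) → F} (hg : AEStronglyMeasurable g volume) {C : ℝ}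
    (hC : ∀ᵐ x, ‖g x‖ ≤ C) : LocallyIntegrable g volume :=
  (memLp_top_of_bound hg C hC).locallyIntegrable le_top

/-- By Rademacher's theorem, `∇ u` represents the line derivatives almost everywhere; integration by
parts in each fixed direction `v` then gives the vector identity. -/
theorem LipschitzWith.hasWeakGradient {K : ℝ≥0} (hu : LipschitzWith K u) :
    HasWeakGradient u (∇ u) := by
  have hG : LocallyIntegrable (∇ u) volume := locallyIntegrable_of_norm_le
    measurable_gradient.aestronglyMeasurable (.of_forall hu.norm_gradient_le)
  refine ⟨hu.continuous.locallyIntegrable, hG, fun φ hφ => ?_⟩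
  obtain ⟨D, hD⟩ := ContDiff.lipschitzWith_of_hasCompactSupport hφ.2 hφ.1 (by simp)
  have hi1 : Integrable (fun x => u x • ∇ φ x) :=
    (hu.continuous.smul hφ.continuous_gradient).integrable_of_hasCompactSupport
      hφ.2.gradient.smul_left
  have hi2 : Integrable (fun x => φ x • ∇ u x) :=
    hG.integrable_smul_left_of_hasCompactSupport hφ.continuous hφ.2
  refine ext_inner_left ℝ fun v => ?_
  rw [inner_neg_right, ← integral_inner hi1, ← integral_inner hi2]
  have key := hu.integral_lineDeriv_mul_eq (μ := volume) hD hφ.2 v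
  have e1 : ∫ x, lineDeriv ℝ u x v * φ x = ∫ x, ⟪v, φ x • ∇ u x⟫ := by
    refine integral_congr_ae ?_
    filter_upwards [hu.ae_differentiableAt] with x hx
    rw [hx.lineDeriv_eq_fderiv, inner_smul_right, real_inner_comm, inner_gradient_left, mul_comm]
  have e2 : ∫ x, lineDeriv ℝ φ x (-v) * u x = - ∫ x, ⟪v, u x • ∇ φ x⟫ := by
    rw [← integral_neg]
    refine integral_congr_ae (.of_forall fun x => ?_)
    simp only
    rw [(hφ.differentiable x).lineDeriv_eq_fderiv, inner_smul_right, real_inner_comm,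
      inner_gradient_left, map_neg]
    ring
  rw [← e1, key, e2, neg_neg]

theorem HasWeakGradient.ae_eq (h : HasWeakGradient u G) (h' : HasWeakGradient u G') :
    G =ᵐ[volume] G' := by
  refine ae_eq_of_integral_contDiff_smul_eq h.2.1 h'.2.1 fun φ hφ hc => ?_
  have := (h.2.2 φ ⟨hφ, hc⟩).symm.trans (h'.2.2 φ ⟨hφ, hc⟩)
  exact neg_injective this

/-- The derivative of the convolution falls on `φ`. The reflected translate `t ↦ φ (x - t)` is
itself a test function, and the sign from the reflection cancels the one in the definition of the
weak gradient. -/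
theorem HasWeakGradient.hasGradientAt_convolution (h : HasWeakGradient u G)
    (hφ : IsTestFunction φ) (x : EuclideanSpace ℝ (Fin N)) :
    HasGradientAt (φ ⋆[lsmul ℝ ℝ, volume] u) ((φ ⋆[lsmul ℝ ℝ, volume] G) x) x := by
  have hd := hφ.2.hasFDerivAt_convolution_left (lsmul ℝ ℝ) (hφ.1.of_le (by simp)) h.1 x
  rw [hasGradientAt_iff_hasFDerivAt]
  suffices H : InnerProductSpace.toDual ℝ _ ((φ ⋆[lsmul ℝ ℝ, volume] G) x) =
      (fderiv ℝ φ ⋆[(lsmul ℝ ℝ).precompL (EuclideanSpace ℝ (Fin N)), volume] u) x by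
    rw [H]
    exact hd
  have ht : IsTestFunction fun t => φ (x - t) :=
    ⟨hφ.1.comp (contDiff_const.sub contDiff_id), hφ.2.comp_homeomorph (Homeomorph.subLeft x)⟩
  have hg (t) : ∇ (fun t => φ (x - t)) t = - ∇ φ (x - t) := by
    refine ext_inner_right ℝ fun v => ?_
    rw [inner_gradient_left, inner_neg_left, inner_gradient_left]
    have h1 := (hφ.differentiable (x - t)).hasFDerivAt.comp t ((hasFDerivAt_id t).const_sub x)
    rw [show (fun t => φ (x - t)) = φ ∘ HSub.hSub x from rfl, h1.fderiv]
    simp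
  have hw := h.2.2 _ ht
  simp only [hg, smul_neg, integral_neg, neg_inj] at hw
  rw [convolution_eq_swap, convolution_eq_swap]
  simp only [ContinuousLinearMap.lsmul_apply]
  rw [← hw]
  have hi1 : Integrable (fun t => u t • ∇ φ (x - t)) := by
    refine h.1.integrable_smul_right_of_hasCompactSupport ?_ ?_
    · exact hφ.continuous_gradient.comp (by fun_prop)
    · exact hφ.2.gradient.comp_homeomorph (Homeomorph.subLeft x)
  have hce : Integrable (fun t => ((lsmul ℝ ℝ).precompL (EuclideanSpace ℝ (Fin N)))
      (fderiv ℝ φ (x - t)) (u t)) :=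
    ((hφ.2.fderiv ℝ).convolutionExists_left _
      (hφ.1.continuous_fderiv (by simp)) h.1 x).integrable_swap
  ext v
  rw [ContinuousLinearMap.integral_apply hce, InnerProductSpace.toDual_apply_apply,
    real_inner_comm, ← integral_inner hi1]
  refine integral_congr_ae (.of_forall fun t => ?_)
  simp only [inner_smul_right, ContinuousLinearMap.precompL_apply]
  rw [real_inner_comm, inner_gradient_left, ContinuousLinearMap.lsmul_apply, smul_eq_mul, mul_comm]

theorem norm_bump_convolution_le {F : Type*} [NormedAddCommGroup F] [NormedSpace ℝ F]
    (ρ : ContDiffBump (0 : EuclideanSpace ℝ (Fin N))) {g : EuclideanSpace ℝ (Fin N) → F} {C : ℝ}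
    (hC : ∀ᵐ x, ‖g x‖ ≤ C) (x : EuclideanSpace ℝ (Fin N)) :
    ‖(ρ.normed volume ⋆[lsmul ℝ ℝ, volume] g) x‖ ≤ C := by
  rw [convolution_eq_swap]
  have h1 : Integrable (fun t => ρ.normed volume (x - t)) := ρ.integrable_normed.comp_sub_left x
  calc _ ≤ ∫ t, ρ.normed volume (x - t) * C := by
        refine norm_integral_le_of_norm_le (h1.mul_const C) ?_
        filter_upwards [hC] with t ht
        rw [ContinuousLinearMap.lsmul_apply, norm_smul, Real.norm_of_nonneg (ρ.nonneg_normed _)]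
        exact mul_le_mul_of_nonneg_left ht (ρ.nonneg_normed _)
    _ = C := by
        rw [integral_mul_const, integral_sub_left_eq_self (fun t => ρ.normed volume t),
          ρ.integral_normed, one_mul]

/-- A sequence of bump functions shrinking to the origin. -/
noncomputable def shrinkingBump (N : ℕ) (n : ℕ) : ContDiffBump (0 : EuclideanSpace ℝ (Fin N)) where
  rIn := 1 / (n + 1) / 2
  rOut := 1 / (n + 1)
  rIn_pos := by positivity
  rIn_lt_rOut := by
    have : (0 : ℝ) < 1 / (n + 1) := by positivity
    linarith

theorem tendsto_shrinkingBump_rOut : Tendsto (fun n => (shrinkingBump N n).rOut) atTop (𝓝 0) :=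
  tendsto_one_div_add_atTop_nhds_zero_nat

theorem isTestFunction_normed (ρ : ContDiffBump (0 : EuclideanSpace ℝ (Fin N))) :
    IsTestFunction (ρ.normed volume) :=
  ⟨ρ.contDiff_normed, ρ.hasCompactSupport_normed⟩

/-- A continuous function whose weak gradient is bounded by `K` is `K`-Lipschitz. -/
theorem HasWeakGradient.lipschitzWith (h : HasWeakGradient u G) (hu : Continuous u) {K : ℝ≥0}
    (hG : ∀ᵐ x, ‖G x‖ ≤ K) : LipschitzWith K u := by
  -- Averaging does not increase the bound on the gradient, so all mollifications are `K`-Lipschitz,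
  -- and the property passes to the pointwise limit.
  have hl (n : ℕ) : LipschitzWith K
      ((shrinkingBump N n).normed volume ⋆[lsmul ℝ ℝ, volume] u) := by
    have hd := h.hasGradientAt_convolution (isTestFunction_normed (shrinkingBump N n))
    refine lipschitzWith_of_nnnorm_fderiv_le (𝕜 := ℝ)
      (fun x => (hd x).differentiableAt) fun x => ?_
    rw [← NNReal.coe_le_coe, coe_nnnorm, ← norm_gradient_eq, (hd x).gradient]
    exact norm_bump_convolution_le _ hG x
  refine LipschitzWith.of_dist_le_mul fun x y => ?_
  have ht (x) := ContDiffBump.convolution_tendsto_right_of_continuous (μ := volume)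
    (tendsto_shrinkingBump_rOut (N := N)) hu x
  exact le_of_tendsto ((ht x).dist (ht y)) (.of_forall fun n => (hl n).dist_le_mul x y)

end WeakGradient

/-! ### Approximation by test functions -/

section TestLimit

/-- Dominated convergence in `L^p`. -/
theorem tendsto_eLpNorm_zero_of_dominated {α F : Type*} [MeasurableSpace α] {μ : Measure α}
    [NormedAddCommGroup F] {p : ℝ≥0∞} (hp0 : p ≠ 0) (hp : p ≠ ⊤) {f : ℕ → α → F} {b : α → ℝ}
    (hf : ∀ n, AEStronglyMeasurable (f n) μ) (hb : MemLp b p μ)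
    (hfb : ∀ n, ∀ᵐ x ∂μ, ‖f n x‖ ≤ b x) (hlim : ∀ᵐ x ∂μ, Tendsto (fun n => f n x) atTop (𝓝 0)) :
    Tendsto (fun n => eLpNorm (f n) p μ) atTop (𝓝 0) := by
  have hpr : 0 < p.toReal := ENNReal.toReal_pos hp0 hp
  have hI : Tendsto (fun n => ∫⁻ x, ‖f n x‖ₑ ^ p.toReal ∂μ) atTop (𝓝 (∫⁻ _, 0 ∂μ)) := by
    refine tendsto_lintegral_of_dominated_convergence' (fun x => ‖b x‖ₑ ^ p.toReal)
      (fun n => (hf n).enorm.pow_const _) ?_ ?_ ?_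
    · intro n
      filter_upwards [hfb n] with x hx
      gcongr
      exact enorm_le_iff_norm_le.2 (hx.trans (le_abs_self _))
    · exact (lintegral_rpow_enorm_lt_top_of_eLpNorm_lt_top hp0 hp hb.2).ne
    · filter_upwards [hlim] with x hx
      have h1 : Tendsto (fun n => ‖f n x‖ₑ) atTop (𝓝 0) := by simpa using hx.enorm
      have h2 := (ENNReal.continuous_rpow_const (y := p.toReal)).tendsto 0
      rw [ENNReal.zero_rpow_of_pos hpr] at h2
      exact h2.comp h1
  simp_rw [eLpNorm_eq_lintegral_rpow_enorm_toReal hp0 hp]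
  have h2 := (ENNReal.continuous_rpow_const (y := 1 / p.toReal)).tendsto 0
  rw [ENNReal.zero_rpow_of_pos (by positivity)] at h2
  refine h2.comp ?_
  simpa using hI

variable {N : ℕ} {u : EuclideanSpace ℝ (Fin N) → ℝ}
  {G : EuclideanSpace ℝ (Fin N) → EuclideanSpace ℝ (Fin N)}

/-- `(u, G)` is the limit of pairs `(φ, ∇ φ)`, with `φ` a test function, in `L^{2*} × L²`. -/
def IsTestLimit (u : EuclideanSpace ℝ (Fin N) → ℝ)
    (G : EuclideanSpace ℝ (Fin N) → EuclideanSpace ℝ (Fin N)) : Prop :=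
  ∃ φ : ℕ → EuclideanSpace ℝ (Fin N) → ℝ,
    (∀ n, IsTestFunction (φ n)) ∧
    Tendsto (fun n => eLpNorm (fun x => ∇ (φ n) x - G x) 2 volume) atTop (𝓝 0) ∧
    Tendsto (fun n => eLpNorm (fun x => φ n x - u x) (sobolevExponent N) volume) atTop (𝓝 0)

theorem bump_convolution_eq_zero {F : Type*} [NormedAddCommGroup F] [NormedSpace ℝ F]
    {g : EuclideanSpace ℝ (Fin N) → F} {R : ℝ} (hR : ∀ x, R < ‖x‖ → g x = 0) (n : ℕ)
    {x : EuclideanSpace ℝ (Fin N)} (hx : R + 1 < ‖x‖) :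
    ((shrinkingBump N n).normed volume ⋆[lsmul ℝ ℝ, volume] g) x = 0 := by
  rw [convolution_eq_swap]
  refine integral_eq_zero_of_ae (.of_forall fun t => ?_)
  simp only [ContinuousLinearMap.lsmul_apply, Pi.zero_apply]
  by_cases ht : R < ‖t‖
  · rw [hR t ht, smul_zero]
  · have hxt : 1 ≤ ‖x - t‖ := by linarith [norm_sub_norm_le x t]
    have hr : (shrinkingBump N n).rOut ≤ 1 := by
      change 1 / ((n : ℝ) + 1) ≤ 1
      rw [div_le_one (by positivity)]
      linarith [n.cast_nonneg (α := ℝ)]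
    have : (shrinkingBump N n).normed volume (x - t) = 0 := by
      rw [← Function.notMem_support, ContDiffBump.support_normed_eq]
      simp only [Metric.mem_ball, dist_zero_right, not_lt]
      linarith
    rw [this, zero_smul]

theorem tendsto_eLpNorm_bump_convolution_sub {F : Type*} [NormedAddCommGroup F] [NormedSpace ℝ F]
    [CompleteSpace F] {p : ℝ≥0∞} (hp0 : p ≠ 0) (hp : p ≠ ⊤) {g : EuclideanSpace ℝ (Fin N) → F}
    (hg : AEStronglyMeasurable g volume) {C R : ℝ} (hC : ∀ x, ‖g x‖ ≤ C)
    (hR : ∀ x, R < ‖x‖ → g x = 0) :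
    Tendsto (fun n => eLpNorm (fun x =>
      ((shrinkingBump N n).normed volume ⋆[lsmul ℝ ℝ, volume] g) x - g x) p volume)
      atTop (𝓝 0) := by
  have hC0 : 0 ≤ C := (norm_nonneg _).trans (hC 0)
  have hli : LocallyIntegrable g volume := locallyIntegrable_of_norm_le hg (.of_forall hC)
  refine tendsto_eLpNorm_zero_of_dominated hp0 hp
    (b := (Metric.closedBall 0 (R + 1)).indicator fun _ => C + C) (fun n => ?_) ?_ (fun n => ?_) ?_
  · refine AEStronglyMeasurable.sub (Continuous.aestronglyMeasurable ?_) hg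
    exact ((shrinkingBump N n).hasCompactSupport_normed).continuous_convolution_left _
      (shrinkingBump N n).continuous_normed hli
  · exact memLp_indicator_const p measurableSet_closedBall _
      (.inr measure_closedBall_lt_top.ne)
  · refine .of_forall fun x => ?_
    by_cases hx : R + 1 < ‖x‖
    · rw [bump_convolution_eq_zero hR n hx, hR x (by linarith), sub_zero, norm_zero]
      exact Set.indicator_nonneg (fun _ _ => by positivity) _
    · rw [Set.indicator_of_mem (by simpa using hx)]
      exact (norm_sub_le _ _).trans <|
        add_le_add (norm_bump_convolution_le _ (.of_forall hC) x) (hC x)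
  -- Pointwise convergence is Lebesgue differentiation, which needs a bounded ratio of the radii;
  -- here the outer radius is twice the inner one, hence `K = 2`.
  · have := ContDiffBump.ae_convolution_tendsto_right_of_locallyIntegrable (μ := volume)
      (φ := shrinkingBump N) (l := atTop) (K := 2) tendsto_shrinkingBump_rOut
      (.of_forall fun n => ?_) hli
    · filter_upwards [this] with x hx
      simpa using hx.sub_const (g x)
    · change 1 / ((n : ℝ) + 1) ≤ 2 * (1 / (n + 1) / 2)
      linarith

theorem sobolevExponent_eq (hN : 3 ≤ N) :
    1 ≤ sobolevExponent N ∧ sobolevExponent N ≠ ⊤ ∧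
      (sobolevExponent N).toReal = 2 * (N : ℝ) / ((N : ℝ) - 2) := by
  have h3 : (3 : ℝ) ≤ N := by exact_mod_cast hN
  have h1 : 1 ≤ 2 * (N : ℝ) / ((N : ℝ) - 2) := by
    rw [le_div_iff₀ (by linarith)]
    linarith
  exact ⟨ENNReal.one_le_ofReal.2 h1, ENNReal.ofReal_ne_top, ENNReal.toReal_ofReal (by linarith)⟩

theorem LipschitzWith.isTestLimit_of_hasCompactSupport (hN : 3 ≤ N) {K : ℝ≥0}
    (hu : LipschitzWith K u) (hc : HasCompactSupport u) : IsTestLimit u (∇ u) := by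
  obtain ⟨hq1, hq, -⟩ := sobolevExponent_eq hN
  obtain ⟨R, hR⟩ := hc.isCompact.isBounded.subset_closedBall 0
  obtain ⟨C, hC⟩ := hu.continuous.bounded_above_of_compact_support hc
  have hR1 (x : EuclideanSpace ℝ (Fin N)) (hx : R < ‖x‖) : u x = 0 :=
    image_eq_zero_of_notMem_tsupport fun h =>
      (mem_closedBall_zero_iff.1 (hR h)).not_gt hx
  have hR2 (x : EuclideanSpace ℝ (Fin N)) (hx : R < ‖x‖) : ∇ u x = 0 := by
    have : x ∉ tsupport u := fun h => (mem_closedBall_zero_iff.1 (hR h)).not_gt hx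
    rw [gradient, fderiv_of_notMem_tsupport ℝ this, map_zero]
  have hw := hu.hasWeakGradient
  have ht (n : ℕ) := isTestFunction_normed (shrinkingBump N n)
  refine ⟨fun n => (shrinkingBump N n).normed volume ⋆[lsmul ℝ ℝ, volume] u,
    fun n => ⟨?_, ?_⟩, ?_, ?_⟩
  · exact (ht n).2.contDiff_convolution_left _ (ht n).1 hw.1
  · exact (ht n).2.convolution _ hc
  · simp_rw [(hw.hasGradientAt_convolution (ht _) _).gradient]
    exact tendsto_eLpNorm_bump_convolution_sub (by simp) (by simp)
      measurable_gradient.aestronglyMeasurable hu.norm_gradient_le hR2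
  · exact tendsto_eLpNorm_bump_convolution_sub (zero_lt_one.trans_le hq1).ne' hq
      hu.continuous.aestronglyMeasurable hC hR1

/-- Diagonal argument: a test function within `1/(k+1)` of the `k`-th pair in both norms. -/
theorem IsTestLimit.of_tendsto (hN : 3 ≤ N) {v : ℕ → EuclideanSpace ℝ (Fin N) → ℝ}
    {H : ℕ → EuclideanSpace ℝ (Fin N) → EuclideanSpace ℝ (Fin N)}
    (h : ∀ k, IsTestLimit (v k) (H k)) (hv : ∀ k, AEStronglyMeasurable (v k) volume)
    (hH : ∀ k, AEStronglyMeasurable (H k) volume) (hu : AEStronglyMeasurable u volume)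
    (hG : AEStronglyMeasurable G volume)
    (hHG : Tendsto (fun n => eLpNorm (fun x => H n x - G x) 2 volume) atTop (𝓝 0))
    (hvu : Tendsto (fun n => eLpNorm (fun x => v n x - u x) (sobolevExponent N) volume)
      atTop (𝓝 0)) : IsTestLimit u G := by
  obtain ⟨hq1, hq, -⟩ := sobolevExponent_eq hN
  have hε (k : ℕ) : (0 : ℝ≥0∞) < ((k : ℝ≥0∞) + 1)⁻¹ := by simp
  have hex (k : ℕ) : ∃ φ, IsTestFunction φ ∧
      eLpNorm (fun x => ∇ φ x - H k x) 2 volume < ((k : ℝ≥0∞) + 1)⁻¹ ∧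
      eLpNorm (fun x => φ x - v k x) (sobolevExponent N) volume < ((k : ℝ≥0∞) + 1)⁻¹ := by
    obtain ⟨φ, hφ, h1, h2⟩ := h k
    obtain ⟨n, hn1, hn2⟩ := ((h1.eventually_lt_const (hε k)).and
      (h2.eventually_lt_const (hε k))).exists
    exact ⟨φ n, hφ n, hn1, hn2⟩
  choose φ hφ h1 h2 using hex
  have hlim : Tendsto (fun k : ℕ => ((k : ℝ≥0∞) + 1)⁻¹) atTop (𝓝 0) := by
    have := (tendsto_add_atTop_iff_nat 1).2 ENNReal.tendsto_inv_nat_nhds_zero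
    simpa using this
  refine ⟨φ, hφ, ?_, ?_⟩
  · have hs := hlim.add hHG
    rw [add_zero] at hs
    refine tendsto_of_tendsto_of_tendsto_of_le_of_le tendsto_const_nhds hs
      (fun _ => zero_le) fun k => ?_
    have hm := (hφ k).continuous_gradient.aestronglyMeasurable (μ := volume)
    calc _ = eLpNorm ((fun x => ∇ (φ k) x - H k x) + fun x => H k x - G x) 2 volume := by
          congr 1
          ext1 x
          simp
      _ ≤ _ := eLpNorm_add_le (hm.sub (hH k)) ((hH k).sub hG) (by simp)
      _ ≤ _ := add_le_add_left (h1 k).le _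
  · have hs := hlim.add hvu
    rw [add_zero] at hs
    refine tendsto_of_tendsto_of_tendsto_of_le_of_le tendsto_const_nhds hs
      (fun _ => zero_le) fun k => ?_
    have hm := (hφ k).continuous.aestronglyMeasurable (μ := volume)
    calc _ = eLpNorm ((fun x => φ k x - v k x) + fun x => v k x - u x)
            (sobolevExponent N) volume := by
          congr 1
          ext1 x
          simp
      _ ≤ _ := eLpNorm_add_le (hm.sub (hv k)) ((hv k).sub hu) hq1
      _ ≤ _ := add_le_add_left (h2 k).le _

/-- Where `u x ≤ ε` the truncation attains its minimum `0`, so its gradient vanishes even on the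
level set `u = ε`. The formula therefore holds at every point. -/
theorem gradient_max_sub_zero (ε : ℝ) (hu : Continuous u) (x : EuclideanSpace ℝ (Fin N)) :
    (ε < u x → ∇ (fun y => max (u y - ε) 0) x = ∇ u x) ∧
      (u x ≤ ε → ∇ (fun y => max (u y - ε) 0) x = 0) := by
  constructor
  · intro hx
    have : (fun y => max (u y - ε) 0) =ᶠ[𝓝 x] fun y => u y - ε := by
      filter_upwards [hu.continuousAt.eventually_const_lt hx] with y hy
      exact max_eq_left (by linarith)
    rw [this.gradient_eq, gradient, gradient, fderiv_sub_const]
  · intro hx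
    have : IsLocalMin (fun y => max (u y - ε) 0) x := by
      refine .of_forall fun y => ?_
      simp only
      rw [max_eq_right (show u x - ε ≤ 0 by linarith)]
      exact le_max_right _ _
    rw [gradient, this.fderiv_eq_zero, map_zero]

/-- A positive Lipschitz function vanishing at infinity, with the natural integrability, is a
limit of test functions. -/
theorem LipschitzWith.isTestLimit (hN : 3 ≤ N) {K : ℝ≥0} (hu : LipschitzWith K u)
    (hpos : ∀ x, 0 < u x) (hinf : Tendsto u (cocompact _) (𝓝 0))
    (hq : MemLp u (sobolevExponent N) volume) (hG : MemLp (∇ u) 2 volume) :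
    IsTestLimit u (∇ u) := by
  obtain ⟨hq1, hqt, -⟩ := sobolevExponent_eq hN
  have hε (k : ℕ) : (0 : ℝ) < 1 / (k + 1) := by positivity
  have hlip (k : ℕ) : LipschitzWith K fun y => max (u y - 1 / ((k : ℝ) + 1)) 0 := by
    refine LipschitzWith.max_const ?_ 0
    refine LipschitzWith.of_dist_le_mul fun x y => ?_
    rw [dist_sub_right]
    exact hu.dist_le_mul x y
  -- By positivity of `u`, every point eventually lies above the truncation level, so the truncated
  -- gradients there are eventually equal to `∇ u`.
  have hev (x : EuclideanSpace ℝ (Fin N)) : ∀ᶠ k : ℕ in atTop, 1 / ((k : ℝ) + 1) < u x :=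
    tendsto_one_div_add_atTop_nhds_zero_nat.eventually_lt_const (hpos x)
  refine IsTestLimit.of_tendsto hN
    (fun k => (hlip k).isTestLimit_of_hasCompactSupport hN ?_)
    (fun k => (hlip k).continuous.aestronglyMeasurable)
    (fun k => measurable_gradient.aestronglyMeasurable) hu.continuous.aestronglyMeasurable
    measurable_gradient.aestronglyMeasurable ?_ ?_
  -- Decay at infinity makes the truncations compactly supported.
  · have hs := hinf.eventually_lt_const (hε k)
    obtain ⟨t, ht, hts⟩ := mem_cocompact.1 hs
    refine HasCompactSupport.intro ht fun x hx => ?_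
    have : u x < 1 / ((k : ℝ) + 1) := hts hx
    exact max_eq_right (by linarith)
  · refine tendsto_eLpNorm_zero_of_dominated (by simp) (by simp) (b := fun x => ‖∇ u x‖)
      (fun k => (measurable_gradient.sub measurable_gradient).aestronglyMeasurable) hG.norm
      (fun k => .of_forall fun x => ?_) (.of_forall fun x => ?_)
    · rcases lt_or_ge (1 / ((k : ℝ) + 1)) (u x) with h | h
      · rw [(gradient_max_sub_zero _ hu.continuous x).1 h, sub_self, norm_zero]
        exact norm_nonneg _
      · rw [(gradient_max_sub_zero _ hu.continuous x).2 h, zero_sub, norm_neg]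
    · refine tendsto_const_nhds.congr' ?_
      filter_upwards [hev x] with k hk
      rw [(gradient_max_sub_zero _ hu.continuous x).1 hk, sub_self]
  · refine tendsto_eLpNorm_zero_of_dominated (zero_lt_one.trans_le hq1).ne' hqt (b := u)
      (fun k => ((hlip k).continuous.sub hu.continuous).aestronglyMeasurable) hq
      (fun k => .of_forall fun x => ?_) (.of_forall fun x => ?_)
    · rw [Real.norm_eq_abs, abs_le]
      constructor
      · linarith [le_max_right (u x - 1 / ((k : ℝ) + 1)) 0]
      · have := hpos x
        have := hε k
        rcases max_choice (u x - 1 / ((k : ℝ) + 1)) 0 with h | h <;> rw [h] <;> linarith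
    · have h1 : Tendsto (fun k : ℕ => u x - 1 / ((k : ℝ) + 1)) atTop (𝓝 (u x - 0)) :=
        tendsto_const_nhds.sub tendsto_one_div_add_atTop_nhds_zero_nat
      have h2 := (h1.max (tendsto_const_nhds (x := (0 : ℝ)))).sub_const (u x)
      simpa [max_eq_left (hpos x).le] using h2

end TestLimit

/-! ### The radial profile -/

section Profile

/-- The slope of the extremal profile: `1` on the unit interval, `s^{-(N-1)}` beyond it. -/
noncomputable def profileSlope (N : ℕ) (s : ℝ) : ℝ := ((max 1 s)⁻¹) ^ (N - 1)

/-- The maximum `(N-1)/(N-2)` of the extremal profile. -/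
noncomputable def peak (N : ℕ) : ℝ := ((N : ℝ) - 1) / ((N : ℝ) - 2)

/-- The extremal profile: conical on the unit interval, harmonic beyond it. -/
noncomputable def profile (N : ℕ) (r : ℝ) : ℝ := peak N - ∫ s in (0 : ℝ)..r, profileSlope N s

/-- The extremal function. -/
noncomputable def extremal (N : ℕ) (x : EuclideanSpace ℝ (Fin N)) : ℝ := profile N ‖x‖

/-- The gradient of the extremal function. -/
noncomputable def extremalGradient (N : ℕ) (x : EuclideanSpace ℝ (Fin N)) :
    EuclideanSpace ℝ (Fin N) :=
  -(profileSlope N ‖x‖ * ‖x‖⁻¹) • x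

variable {N : ℕ}

theorem continuous_profileSlope : Continuous (profileSlope N) :=
  ((continuous_const.max continuous_id).inv₀ fun s =>
    (zero_lt_one.trans_le (le_max_left 1 s)).ne').pow _

theorem profileSlope_pos (s : ℝ) : 0 < profileSlope N s := by
  have : 0 < max 1 s := zero_lt_one.trans_le (le_max_left 1 s)
  unfold profileSlope
  positivity

theorem profileSlope_le_one (s : ℝ) : profileSlope N s ≤ 1 :=
  pow_le_one₀ (inv_nonneg.2 (zero_le_one.trans (le_max_left 1 s)))
    (inv_le_one_of_one_le₀ (le_max_left 1 s))

theorem profileSlope_of_le_one {s : ℝ} (hs : s ≤ 1) : profileSlope N s = 1 := by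
  simp [profileSlope, max_eq_left hs]

theorem profileSlope_of_one_le {s : ℝ} (hs : 1 ≤ s) : profileSlope N s = s⁻¹ ^ (N - 1) := by
  simp [profileSlope, max_eq_right hs]

theorem hasDerivAt_profile (r : ℝ) : HasDerivAt (profile N) (-profileSlope N r) r :=
  (intervalIntegral.integral_hasDerivAt_right (continuous_profileSlope.intervalIntegrable _ _)
    continuous_profileSlope.aestronglyMeasurable.stronglyMeasurableAtFilter
    continuous_profileSlope.continuousAt).const_sub (peak N)

theorem strictAnti_profile : StrictAnti (profile N) :=
  strictAnti_of_deriv_neg fun r => by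
    rw [(hasDerivAt_profile r).deriv]
    exact neg_lt_zero.2 (profileSlope_pos r)

theorem lipschitzWith_profile : LipschitzWith 1 (profile N) := by
  refine lipschitzWith_of_nnnorm_deriv_le (fun r => (hasDerivAt_profile r).differentiableAt)
    fun r => ?_
  rw [(hasDerivAt_profile r).deriv, nnnorm_neg, ← NNReal.coe_le_coe, coe_nnnorm,
    Real.norm_of_nonneg (profileSlope_pos r).le]
  exact profileSlope_le_one r

theorem profile_zero : profile N 0 = peak N := by simp [profile]

theorem profile_of_le_one {r : ℝ} (h1 : r ≤ 1) : profile N r = peak N - r := by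
  have : ∫ s in (0 : ℝ)..r, profileSlope N s = ∫ _ in (0 : ℝ)..r, (1 : ℝ) :=
    intervalIntegral.integral_congr fun s hs => profileSlope_of_le_one
      (hs.2.trans (max_le zero_le_one h1))
  rw [profile, this]
  simp

/-- The slope has total integral `1 + 1/(N-2) = peak N` over the half-line, so the constants cancel
and only the decaying tail remains. -/
theorem profile_of_one_le (hN : 3 ≤ N) {r : ℝ} (h1 : 1 ≤ r) :
    profile N r = r⁻¹ ^ (N - 2) / ((N : ℝ) - 2) := by
  obtain ⟨n, rfl⟩ : ∃ n, N = n + 3 := ⟨N - 3, by omega⟩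
  have hn : ((n + 3 : ℕ) : ℝ) - 2 = n + 1 := by push_cast; ring
  have hp : (0 : ℝ) < n + 1 := by positivity
  have hd : ∀ s ∈ Set.uIcc 1 r,
      HasDerivAt (fun s : ℝ => -(s⁻¹ ^ (n + 1) / ((n : ℝ) + 1))) (profileSlope (n + 3) s) s := by
    intro s hs
    rw [Set.uIcc_of_le h1] at hs
    have hs0 : s ≠ 0 := by linarith [hs.1]
    refine (((hasDerivAt_inv hs0).pow (n + 1)).div_const ((n : ℝ) + 1)).neg.congr_deriv ?_
    rw [profileSlope_of_one_le hs.1]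
    simp only [Nat.add_sub_cancel, show n + 3 - 1 = n + 2 by omega]
    push_cast
    field_simp
    rw [pow_add]
    field_simp
  have h2 := intervalIntegral.integral_eq_sub_of_hasDerivAt hd
    (continuous_profileSlope.intervalIntegrable _ _)
  have h3 : profile (n + 3) r = profile (n + 3) 1 - ∫ s in (1 : ℝ)..r, profileSlope (n + 3) s := by
    rw [profile, profile, ← intervalIntegral.integral_add_adjacent_intervals
      (continuous_profileSlope.intervalIntegrable 0 1) (continuous_profileSlope.intervalIntegrable 1 r)]
    ring
  rw [h3, profile_of_le_one le_rfl, h2, peak, hn, show n + 3 - 2 = n + 1 by omega]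
  push_cast
  field_simp
  simp only [one_pow]
  ring

theorem one_lt_peak (hN : 3 ≤ N) : 1 < peak N := by
  have h3 : (3 : ℝ) ≤ N := by exact_mod_cast hN
  rw [peak, lt_div_iff₀] <;> linarith

theorem profile_pos (hN : 3 ≤ N) (r : ℝ) : 0 < profile N r := by
  have h3 : (3 : ℝ) ≤ N := by exact_mod_cast hN
  rcases le_total r 1 with h | h
  · rw [profile_of_le_one h]
    linarith [one_lt_peak hN]
  · rw [profile_of_one_le hN h]
    have : 0 < (N : ℝ) - 2 := by linarith
    positivity

/-- A single majorant for both regimes, giving integrability and decay of the extremal function. -/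
theorem profile_le (hN : 3 ≤ N) {r : ℝ} (hr : 0 ≤ r) :
    profile N r ≤ peak N * (max 1 r)⁻¹ ^ (N - 2) := by
  have h3 : (3 : ℝ) ≤ N := by exact_mod_cast hN
  rcases le_total r 1 with h | h
  · rw [max_eq_left h, ← profile_zero]
    simpa using strictAnti_profile.antitone hr
  · have h4 : 0 < (N : ℝ) - 2 := by linarith
    rw [profile_of_one_le hN h, max_eq_right h, peak, div_eq_inv_mul]
    refine mul_le_mul_of_nonneg_right ?_ (by positivity)
    rw [inv_eq_one_div]
    gcongr
    linarith

end Profile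

/-! ### The extremal function belongs to `𝒳` -/

section Extremal

variable {N : ℕ}

theorem lipschitzWith_extremal : LipschitzWith 1 (extremal N) := by
  have h := (lipschitzWith_profile (N := N)).comp
    (lipschitzWith_one_norm (E := EuclideanSpace ℝ (Fin N)))
  rw [one_mul] at h
  exact h

theorem HasFDerivAt.hasGradientAt_of_inner {u : EuclideanSpace ℝ (Fin N) → ℝ}
    {L : StrongDual ℝ (EuclideanSpace ℝ (Fin N))} {x g : EuclideanSpace ℝ (Fin N)}
    (h : HasFDerivAt u L x) (hg : ∀ v, ⟪g, v⟫ = L v) : HasGradientAt u g x := by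
  rw [hasGradientAt_iff_hasFDerivAt,
    show InnerProductSpace.toDual ℝ (EuclideanSpace ℝ (Fin N)) g = L from
      ContinuousLinearMap.ext fun v => by simpa using hg v]
  exact h

theorem hasGradientAt_norm {x : EuclideanSpace ℝ (Fin N)} (hx : x ≠ 0) :
    HasGradientAt (fun y : EuclideanSpace ℝ (Fin N) => ‖y‖) (‖x‖⁻¹ • x) x := by
  have h1 := (hasStrictFDerivAt_norm_sq x).hasFDerivAt.sqrt (by positivity)
  simp only [Real.sqrt_sq (norm_nonneg _)] at h1
  refine h1.hasGradientAt_of_inner fun v => ?_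
  simp [inner_smul_left]
  ring

theorem hasGradientAt_extremal {x : EuclideanSpace ℝ (Fin N)} (hx : x ≠ 0) :
    HasGradientAt (extremal N) (extremalGradient N x) x := by
  have h1 := (hasDerivAt_profile (N := N) ‖x‖).comp_hasFDerivAt x
    (hasGradientAt_norm hx).hasFDerivAt
  refine HasFDerivAt.hasGradientAt_of_inner (u := extremal N) h1 fun v => ?_
  simp [extremalGradient, inner_smul_left]
  ring

theorem nontrivial_euclideanSpace (hN : 3 ≤ N) : Nontrivial (EuclideanSpace ℝ (Fin N)) := by
  have : Nonempty (Fin N) := ⟨⟨0, by omega⟩⟩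
  infer_instance

theorem ae_ne_zero (hN : 3 ≤ N) : ∀ᵐ x : EuclideanSpace ℝ (Fin N), x ≠ 0 := by
  have := nontrivial_euclideanSpace hN
  exact Measure.ae_ne volume 0

theorem gradient_extremal_ae_eq (hN : 3 ≤ N) :
    ∇ (extremal N) =ᵐ[volume] extremalGradient N := by
  filter_upwards [ae_ne_zero hN] with x hx
  exact (hasGradientAt_extremal hx).gradient

theorem norm_extremalGradient {x : EuclideanSpace ℝ (Fin N)} (hx : x ≠ 0) :
    ‖extremalGradient N x‖ = profileSlope N ‖x‖ := by
  have hx' : ‖x‖ ≠ 0 := norm_ne_zero_iff.2 hx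
  rw [extremalGradient, norm_smul, norm_neg, norm_mul, norm_inv, norm_norm,
    Real.norm_of_nonneg (profileSlope_pos _).le]
  field_simp

/-- Comparison with `(1 + |x|)^(-kp)`, using `1 + |x| ≤ 2 max(1, |x|)`. It serves `U` with `k =
N-2`, `p = 2*`, where `kp = 2N`, and `∇U` with `k = N-1`, `p = 2`, where `kp = 2N-2 > N`. -/
theorem memLp_max_inv_pow {k : ℕ} {p : ℝ≥0∞} (hp0 : p ≠ 0) (hp : p ≠ ⊤)
    (h : (N : ℝ) < k * p.toReal) :
    MemLp (fun x : EuclideanSpace ℝ (Fin N) => (max 1 ‖x‖)⁻¹ ^ k) p volume := by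
  have hm (x : EuclideanSpace ℝ (Fin N)) : 0 < max 1 ‖x‖ :=
    zero_lt_one.trans_le (le_max_left 1 ‖x‖)
  have hc : Continuous fun x : EuclideanSpace ℝ (Fin N) => (max 1 ‖x‖)⁻¹ ^ k :=
    ((continuous_const.max continuous_norm).inv₀ fun x => (hm x).ne').pow _
  rw [← integrable_norm_rpow_iff hc.aestronglyMeasurable hp0 hp]
  have hI := (integrable_one_add_norm (E := EuclideanSpace ℝ (Fin N)) (μ := volume)
    (r := k * p.toReal) (by simpa using h)).const_mul (2 ^ (k * p.toReal))
  refine hI.mono' ?_ (.of_forall fun x => ?_)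
  · exact (hc.norm.rpow_const fun x => .inr ENNReal.toReal_nonneg).aestronglyMeasurable
  · have h1 := hm x
    rw [Real.norm_of_nonneg (by positivity), Real.norm_of_nonneg (by positivity),
      ← Real.rpow_natCast, ← Real.rpow_mul (by positivity), Real.inv_rpow h1.le,
      Real.rpow_neg (by positivity), ← Real.inv_rpow h1.le, ← Real.inv_rpow (by positivity),
      ← Real.mul_rpow (by positivity) (by positivity)]
    refine Real.rpow_le_rpow (by positivity) ?_ (by positivity)
    rw [← div_eq_mul_inv, inv_eq_one_div, div_le_div_iff₀ h1 (by positivity)]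
    linarith [le_max_left 1 ‖x‖, le_max_right 1 ‖x‖]

theorem memLp_extremal (hN : 3 ≤ N) : MemLp (extremal N) (sobolevExponent N) volume := by
  have h3 : (3 : ℝ) ≤ N := by exact_mod_cast hN
  obtain ⟨hq1, hq, hqr⟩ := sobolevExponent_eq hN
  refine ((memLp_max_inv_pow (N := N) (k := N - 2) (zero_lt_one.trans_le hq1).ne' hq ?_).const_mul
    (peak N)).mono' lipschitzWith_extremal.continuous.aestronglyMeasurable (.of_forall fun x => ?_)
  · have h4 : (0 : ℝ) < (N : ℝ) - 2 := by linarith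
    rw [hqr, Nat.cast_sub (by omega), Nat.cast_ofNat]
    field_simp
    linarith
  · rw [extremal, Real.norm_of_nonneg (profile_pos hN _).le]
    exact profile_le hN (norm_nonneg x)

theorem memLp_extremalGradient (hN : 3 ≤ N) : MemLp (extremalGradient N) 2 volume := by
  have h3 : (3 : ℝ) ≤ N := by exact_mod_cast hN
  refine (memLp_max_inv_pow (N := N) (k := N - 1) (p := 2) (by simp) (by simp) ?_).mono' ?_ ?_
  · rw [Nat.cast_sub (by omega)]
    simp
    linarith
  · exact (measurable_gradient.aestronglyMeasurable).congr (gradient_extremal_ae_eq hN)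
  · filter_upwards [ae_ne_zero hN] with x hx
    rw [norm_extremalGradient hx, profileSlope]

theorem tendsto_extremal (hN : 3 ≤ N) : Tendsto (extremal N) (cocompact _) (𝓝 0) := by
  have h1 : Tendsto (fun r : ℝ => peak N * (max 1 r)⁻¹ ^ (N - 2)) atTop (𝓝 0) := by
    have h2 : Tendsto (fun r : ℝ => max 1 r) atTop atTop :=
      tendsto_atTop_mono (fun r => le_max_right 1 r) tendsto_id
    have h3 := ((tendsto_inv_atTop_zero.comp h2).pow (N - 2)).const_mul (peak N)
    simpa [show N - 2 ≠ 0 by omega] using h3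
  exact tendsto_of_tendsto_of_tendsto_of_le_of_le tendsto_const_nhds
    (h1.comp tendsto_norm_cocompact_atTop) (fun _ => (profile_pos hN _).le)
    fun x => profile_le hN (norm_nonneg x)

theorem isTestLimit_extremal (hN : 3 ≤ N) : IsTestLimit (extremal N) (∇ (extremal N)) :=
  lipschitzWith_extremal.isTestLimit hN (fun _ => profile_pos hN _) (tendsto_extremal hN)
    (memLp_extremal hN) ((memLp_congr_ae (gradient_extremal_ae_eq hN)).2
      (memLp_extremalGradient hN))

theorem extremal_mem_spaceX (hN : 3 ≤ N) : extremal N ∈ spaceX N :=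
  ⟨⟨∇ (extremal N), lipschitzWith_extremal.hasWeakGradient,
    (memLp_congr_ae (gradient_extremal_ae_eq hN)).2 (memLp_extremalGradient hN),
    isTestLimit_extremal hN⟩, ⟨1, lipschitzWith_extremal⟩,
    .of_forall fun x => by simpa using lipschitzWith_extremal.norm_gradient_le x⟩

end Extremal

/-! ### Hölder pairings and their continuity -/

section Holder

variable {α F : Type*} [MeasurableSpace α] {μ : Measure α} [NormedAddCommGroup F]
  [InnerProductSpace ℝ F] {p q : ℝ≥0∞}

theorem eLpNorm_inner_le [p.HolderConjugate q] {f g : α → F} (hf : AEStronglyMeasurable f μ)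
    (hg : AEStronglyMeasurable g μ) :
    eLpNorm (fun x => ⟪f x, g x⟫) 1 μ ≤ eLpNorm f p μ * eLpNorm g q μ := by
  have := eLpNorm_le_eLpNorm_mul_eLpNorm_of_nnnorm (p := p) (q := q) (r := 1) hf hg
    (fun a b => ⟪a, b⟫) 1 (.of_forall fun x => by
      rw [one_mul]
      exact norm_inner_le_norm (𝕜 := ℝ) (f x) (g x))
  simpa using this

theorem integrable_inner_of_holderConjugate [p.HolderConjugate q] {f g : α → F}
    (hf : MemLp f p μ) (hg : MemLp g q μ) : Integrable (fun x => ⟪f x, g x⟫) μ := by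
  rw [← memLp_one_iff_integrable]
  exact ⟨hf.1.inner hg.1, (eLpNorm_inner_le hf.1 hg.1).trans_lt (ENNReal.mul_lt_top hf.2 hg.2)⟩

theorem tendsto_integral_inner [p.HolderConjugate q] {f g : α → F} {G : ℕ → α → F}
    (hf : MemLp f p μ) (hg : MemLp g q μ) (hG : ∀ n, MemLp (G n) q μ)
    (h : Tendsto (fun n => eLpNorm (fun x => G n x - g x) q μ) atTop (𝓝 0)) :
    Tendsto (fun n => ∫ x, ⟪f x, G n x⟫ ∂μ) atTop (𝓝 (∫ x, ⟪f x, g x⟫ ∂μ)) := by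
  refine tendsto_integral_of_L1' _ (hf.1.inner hg.1)
    (.of_forall fun n => integrable_inner_of_holderConjugate hf (hG n)) ?_
  have h1 := ENNReal.Tendsto.const_mul h (.inr hf.2.ne)
  rw [mul_zero] at h1
  refine tendsto_of_tendsto_of_tendsto_of_le_of_le tendsto_const_nhds h1 (fun _ => zero_le)
    fun n => ?_
  refine le_trans (le_of_eq ?_) (eLpNorm_inner_le (p := p) (q := q) hf.1 ((hG n).1.sub hg.1))
  congr 1
  ext1 x
  simp [inner_sub_right]

end Holder

/-! ### The weak equation of the extremal function -/

section Polar

/-- Integration in polar coordinates. -/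
theorem integral_eq_integral_sphere_integral_Ioi {E : Type*} [NormedAddCommGroup E]
    [NormedSpace ℝ E] [Nontrivial E] [MeasurableSpace E] [BorelSpace E] [FiniteDimensional ℝ E]
    (μ : Measure E) [μ.IsAddHaarMeasure] {F : E → ℝ} (hF : Integrable F μ) :
    ∫ x, F x ∂μ = ∫ θ : Metric.sphere (0 : E) 1, ∫ r in Set.Ioi (0 : ℝ),
      r ^ (Module.finrank ℝ E - 1) * F (r • (θ : E)) ∂volume ∂μ.toSphere := by
  have hme := (homeomorphUnitSphereProd E).measurableEmbedding
  have hmp := μ.measurePreserving_homeomorphUnitSphereProd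
  have hcomp (x : ({0}ᶜ : Set E)) : F ((homeomorphUnitSphereProd E x).2.1 •
      ((homeomorphUnitSphereProd E x).1 : E)) = F x := by
    have := congrArg Subtype.val ((homeomorphUnitSphereProd E).symm_apply_apply x)
    rw [homeomorphUnitSphereProd_symm_apply_coe] at this
    rw [this]
  have hint : Integrable (fun y : Metric.sphere (0 : E) 1 × Set.Ioi (0 : ℝ) =>
      F (y.2.1 • (y.1 : E))) (μ.toSphere.prod (.volumeIoiPow (Module.finrank ℝ E - 1))) := by
    rw [← hmp.integrable_comp_emb hme]
    simp only [Function.comp_def, hcomp]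
    have := (integrableOn_iff_comap_subtypeVal (measurableSet_singleton (0 : E)).compl).1
      hF.integrableOn
    exact this
  calc ∫ x, F x ∂μ = ∫ x : ({(0)}ᶜ : Set E), F x ∂(μ.comap (↑)) := by
        rw [integral_subtype_comap (measurableSet_singleton _).compl F,
          restrict_compl_singleton]
    _ = ∫ y, F (y.2.1 • (y.1 : E)) ∂μ.toSphere.prod (.volumeIoiPow (Module.finrank ℝ E - 1)) := by
        rw [← hmp.integral_comp hme]
        simp only [hcomp]
    _ = _ := by
        rw [integral_prod _ hint]
        refine integral_congr_ae (.of_forall fun θ => ?_)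
        simp only [Measure.volumeIoiPow, ENNReal.ofReal]
        rw [integral_withDensity_eq_integral_smul
          ((measurable_subtype_coe.pow_const _).real_toNNReal),
          integral_subtype_comap measurableSet_Ioi fun a : ℝ =>
            Real.toNNReal (a ^ (Module.finrank ℝ E - 1)) • F (a • (θ : E))]
        refine setIntegral_congr_fun measurableSet_Ioi fun r hr => ?_
        rw [NNReal.smul_def, Real.coe_toNNReal _ (pow_nonneg (le_of_lt hr) _), smul_eq_mul]

/-- Beyond `r = 1` the weight `r^(N-1) * profileSlope N r` is identically `1`, so that part
integrates to `-g 1`. It cancels the boundary term of the integration by parts on `(0, 1]`: this is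
the absence of a surface measure on the unit sphere. -/
theorem integral_Ioi_pow_mul_profileSlope_mul_deriv {N : ℕ} (hN : 3 ≤ N) {g g' : ℝ → ℝ}
    (hg : ∀ r, HasDerivAt g (g' r) r) (hg' : Continuous g') (hc : HasCompactSupport g) :
    ∫ r in Set.Ioi (0 : ℝ), r ^ (N - 1) * profileSlope N r * g' r =
      - ∫ r in Set.Ioc (0 : ℝ) 1, ((N : ℝ) - 1) * r ^ (N - 2) * g r := by
  have hcg' : HasCompactSupport g' := by
    have := hc.deriv
    rwa [show deriv g = g' from funext fun r => (hg r).deriv] at this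
  have hi : Integrable (fun r => r ^ (N - 1) * profileSlope N r * g' r) :=
    Continuous.integrable_of_hasCompactSupport
      (((continuous_id.pow _).mul continuous_profileSlope).mul hg') hcg'.mul_left
  rw [← Set.Ioc_union_Ioi_eq_Ioi (zero_le_one (α := ℝ)), setIntegral_union
    (Set.Ioc_disjoint_Ioi le_rfl) measurableSet_Ioi hi.integrableOn hi.integrableOn]
  have h1 : ∫ r in Set.Ioi (1 : ℝ), r ^ (N - 1) * profileSlope N r * g' r = - g 1 := by
    rw [setIntegral_congr_fun (g := g') measurableSet_Ioi, integral_Ioi_of_hasDerivAt_of_tendsto'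
      (fun r _ => hg r) (hg'.integrable_of_hasCompactSupport hcg').integrableOn (m := 0), zero_sub]
    · rw [hasCompactSupport_iff_eventuallyEq, coclosedCompact_eq_cocompact] at hc
      exact hc.filter_mono _root_.atTop_le_cocompact |>.tendsto
    · intro r hr
      have hr : 1 < r := hr
      simp only
      rw [profileSlope_of_one_le hr.le, ← mul_pow, mul_inv_cancel₀ (by linarith), one_pow, one_mul]
  have h2 : ∫ r in Set.Ioc (0 : ℝ) 1, r ^ (N - 1) * profileSlope N r * g' r =
      ∫ r in (0 : ℝ)..1, r ^ (N - 1) * g' r := by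
    rw [intervalIntegral.integral_of_le zero_le_one]
    refine setIntegral_congr_fun measurableSet_Ioc fun r hr => ?_
    rw [profileSlope_of_le_one hr.2, mul_one]
  have hd (r : ℝ) : HasDerivAt (fun r : ℝ => r ^ (N - 1)) (((N : ℝ) - 1) * r ^ (N - 2)) r := by
    refine (hasDerivAt_pow (N - 1) r).congr_deriv ?_
    rw [Nat.cast_sub (by omega), Nat.cast_one, show N - 1 - 1 = N - 2 by omega]
  rw [h1, h2, intervalIntegral.integral_mul_deriv_eq_deriv_mul (fun r _ => hd r)
    (fun r _ => hg r) (Continuous.intervalIntegrable (by fun_prop) _ _)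
    (hg'.intervalIntegrable _ _), intervalIntegral.integral_of_le zero_le_one]
  simp only [one_pow, one_mul, zero_pow (show N - 1 ≠ 0 by omega), zero_mul]
  ring

/-- The distributional Laplacian of the extremal function, up to sign. -/
noncomputable def laplaceWeight (N : ℕ) : EuclideanSpace ℝ (Fin N) → ℝ :=
  (Metric.closedBall 0 1).indicator fun x => ((N : ℝ) - 1) * ‖x‖⁻¹

variable {N : ℕ}

theorem laplaceWeight_nonneg (hN : 3 ≤ N) (x : EuclideanSpace ℝ (Fin N)) :
    0 ≤ laplaceWeight N x := by
  have h3 : (3 : ℝ) ≤ N := by exact_mod_cast hN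
  have : (0 : ℝ) ≤ N - 1 := by linarith
  exact Set.indicator_nonneg (fun x _ => by positivity) x

theorem measurable_laplaceWeight : Measurable (laplaceWeight N) :=
  (measurable_norm.inv.const_mul _).indicator measurableSet_closedBall

/-- In polar coordinates the squared singularity `r^(-2)` leaves `r^(N-3)`, bounded near the origin
because `N ≥ 3`. -/
theorem memLp_two_laplaceWeight (hN : 3 ≤ N) : MemLp (laplaceWeight N) 2 volume := by
  have := nontrivial_euclideanSpace hN
  rw [memLp_two_iff_integrable_sq measurable_laplaceWeight.aestronglyMeasurable]
  have h : (fun x : EuclideanSpace ℝ (Fin N) => laplaceWeight N x ^ 2) = fun x =>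
      (fun r : ℝ => (Set.Iic 1).indicator (fun r => (((N : ℝ) - 1) * r⁻¹) ^ 2) r) ‖x‖ := by
    ext x
    by_cases hx : ‖x‖ ≤ 1 <;> simp [laplaceWeight, Set.indicator, hx]
  rw [h, integrable_fun_norm_addHaar]
  simp only [finrank_euclideanSpace, Fintype.card_fin, smul_eq_mul]
  have h2 : IntegrableOn (fun r : ℝ => (Set.Ioc 0 1).indicator
      (fun r => ((N : ℝ) - 1) ^ 2 * r ^ (N - 3)) r) (Set.Ioi 0) := by
    refine Integrable.integrableOn ?_
    rw [integrable_indicator_iff measurableSet_Ioc]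
    exact (Continuous.integrableOn_Icc (by fun_prop)).mono_set Set.Ioc_subset_Icc_self
  refine h2.congr_fun (fun r hr => ?_) measurableSet_Ioi
  have hr : 0 < r := hr
  by_cases hr1 : r ≤ 1
  · simp only [Set.indicator, Set.mem_Ioc, hr, hr1, Set.mem_Iic, and_self, if_true]
    rw [show N - 1 = (N - 3) + 2 by omega, pow_add]
    field_simp
  · simp [Set.indicator, hr1]

theorem memLp_laplaceWeight (hN : 3 ≤ N) {p : ℝ≥0∞} (hp : p ≤ 2) :
    MemLp (laplaceWeight N) p volume := by
  have h := memLp_two_laplaceWeight hN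
  rw [laplaceWeight, memLp_indicator_iff_restrict measurableSet_closedBall] at h ⊢
  have : Fact (volume (Metric.closedBall (0 : EuclideanSpace ℝ (Fin N)) 1) < ⊤) :=
    ⟨measure_closedBall_lt_top⟩
  exact h.mono_exponent hp

/-- Along each ray the identity is the one-dimensional integration by parts above, with `g r = φ (r
θ)`. -/
theorem integral_inner_extremalGradient_gradient (hN : 3 ≤ N) {φ : EuclideanSpace ℝ (Fin N) → ℝ}
    (hφ : IsTestFunction φ) :
    ∫ x, ⟪extremalGradient N x, ∇ φ x⟫ = ∫ x, laplaceWeight N x * φ x := by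
  have := nontrivial_euclideanSpace hN
  have hi1 : Integrable fun x => ⟪extremalGradient N x, ∇ φ x⟫ :=
    integrable_inner_of_holderConjugate (memLp_extremalGradient hN) (hφ.memLp_gradient 2)
  have hi2 : Integrable fun x => laplaceWeight N x * φ x :=
    (memLp_two_laplaceWeight hN).integrable_mul (hφ.memLp 2)
  rw [integral_eq_integral_sphere_integral_Ioi _ hi1,
    integral_eq_integral_sphere_integral_Ioi _ hi2]
  refine integral_congr_ae (.of_forall fun θ => ?_)
  simp only [finrank_euclideanSpace, Fintype.card_fin]
  have hθ : ‖(θ : EuclideanSpace ℝ (Fin N))‖ = 1 := by simp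
  have hd (r : ℝ) : HasDerivAt (fun r : ℝ => φ (r • (θ : EuclideanSpace ℝ (Fin N))))
      ⟪∇ φ (r • (θ : EuclideanSpace ℝ (Fin N))), (θ : EuclideanSpace ℝ (Fin N))⟫ r := by
    rw [inner_gradient_left]
    have h1 := (hφ.differentiable (r • (θ : EuclideanSpace ℝ (Fin N)))).hasFDerivAt.comp_hasDerivAt
      r ((hasDerivAt_id r).smul_const (θ : EuclideanSpace ℝ (Fin N)))
    simp only [id, one_smul] at h1
    exact h1
  have hcs : HasCompactSupport fun r : ℝ => φ (r • (θ : EuclideanSpace ℝ (Fin N))) := by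
    obtain ⟨R, hR⟩ := hφ.2.isCompact.isBounded.subset_closedBall 0
    refine HasCompactSupport.intro (isCompact_closedBall 0 R) fun r hr => ?_
    refine image_eq_zero_of_notMem_tsupport fun h => hr ?_
    have := hR h
    simpa [norm_smul, hθ] using this
  have key := integral_Ioi_pow_mul_profileSlope_mul_deriv hN hd
    ((hφ.continuous_gradient.comp (by fun_prop)).inner continuous_const) hcs
  have e1 : ∀ r ∈ Set.Ioi (0 : ℝ), r ^ (N - 1) *
      ⟪extremalGradient N (r • (θ : EuclideanSpace ℝ (Fin N))),
        ∇ φ (r • (θ : EuclideanSpace ℝ (Fin N)))⟫ = -(r ^ (N - 1) * profileSlope N r *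
      ⟪∇ φ (r • (θ : EuclideanSpace ℝ (Fin N))), (θ : EuclideanSpace ℝ (Fin N))⟫) := by
    intro r hr
    have hr : 0 < r := hr
    rw [extremalGradient, norm_smul, hθ, mul_one, Real.norm_of_nonneg hr.le, inner_smul_left,
      inner_smul_left, real_inner_comm]
    simp only [map_neg, conj_trivial]
    field_simp
  have e2 : ∀ r ∈ Set.Ioi (0 : ℝ), r ^ (N - 1) *
      (laplaceWeight N (r • (θ : EuclideanSpace ℝ (Fin N))) *
        φ (r • (θ : EuclideanSpace ℝ (Fin N)))) =
      (Set.Ioc 0 1).indicator (fun r => ((N : ℝ) - 1) * r ^ (N - 2) *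
        φ (r • (θ : EuclideanSpace ℝ (Fin N)))) r := by
    intro r hr
    have hr : 0 < r := hr
    by_cases hr1 : r ≤ 1
    · simp only [laplaceWeight, Set.indicator, mem_closedBall_zero_iff, norm_smul, hθ, mul_one,
        Real.norm_of_nonneg hr.le, hr1, hr, Set.mem_Ioc, and_self, if_true]
      rw [show N - 1 = (N - 2) + 1 by omega, pow_add]
      field_simp
    · simp [laplaceWeight, Set.indicator, norm_smul, hθ, abs_of_pos hr, hr1]
  rw [setIntegral_congr_fun measurableSet_Ioi e1, integral_neg, key, neg_neg,
    setIntegral_congr_fun measurableSet_Ioi e2, setIntegral_indicator measurableSet_Ioc,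
    Set.inter_eq_self_of_subset_right Set.Ioc_subset_Ioi_self]

theorem IsTestLimit.memLp {u : EuclideanSpace ℝ (Fin N) → ℝ}
    {G : EuclideanSpace ℝ (Fin N) → EuclideanSpace ℝ (Fin N)} (h : IsTestLimit u G)
    (hu : AEStronglyMeasurable u volume) : MemLp u (sobolevExponent N) volume := by
  obtain ⟨φ, hφ, -, h2⟩ := h
  obtain ⟨n, hn⟩ := (h2.eventually_lt_const ENNReal.zero_lt_top).exists
  have hs := ((hφ n).memLp (sobolevExponent N)).sub
    (⟨(hφ n).continuous.aestronglyMeasurable.sub hu, hn⟩ :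
      MemLp (fun x => φ n x - u x) (sobolevExponent N) volume)
  refine (memLp_congr_ae (.of_forall fun x => ?_)).1 hs
  simp

/-- The weak form of `-Δ (extremal N) = laplaceWeight N`, tested against limits of test
functions. -/
theorem IsTestLimit.integral_inner_extremalGradient (hN : 3 ≤ N)
    {u : EuclideanSpace ℝ (Fin N) → ℝ}
    {G : EuclideanSpace ℝ (Fin N) → EuclideanSpace ℝ (Fin N)} (h : IsTestLimit u G)
    (hu : AEStronglyMeasurable u volume) (hG : MemLp G 2 volume) :
    Integrable (fun x => laplaceWeight N x * u x) ∧
      ∫ x, ⟪extremalGradient N x, G x⟫ = ∫ x, laplaceWeight N x * u x := by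
  have h3 : (3 : ℝ) ≤ N := by exact_mod_cast hN
  have huq := h.memLp hu
  obtain ⟨φ, hφ, h1, h2⟩ := h
  -- `2N/(N+2)` is the dual of the Sobolev exponent. It is at most `2`, so the weight lies in this
  -- space and the right-hand side is continuous under `L^{2*}` convergence.
  have hconj : (2 * (N : ℝ) / (N + 2)).HolderConjugate (2 * (N : ℝ) / (N - 2)) := by
    rw [Real.holderConjugate_iff]
    have : (N : ℝ) - 2 ≠ 0 := by linarith
    constructor
    · rw [lt_div_iff₀ (by positivity)]
      linarith
    · field_simp
      ring
  have hc : (ENNReal.ofReal (2 * (N : ℝ) / (N + 2))).HolderConjugate (sobolevExponent N) :=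
    hconj.ennrealOfReal
  have hw : MemLp (laplaceWeight N) (ENNReal.ofReal (2 * (N : ℝ) / (N + 2))) volume := by
    refine memLp_laplaceWeight hN ?_
    rw [← ENNReal.ofReal_ofNat]
    refine ENNReal.ofReal_le_ofReal ?_
    rw [div_le_iff₀ (by positivity)]
    linarith
  have ha := tendsto_integral_inner (memLp_extremalGradient hN) hG
    (fun n => (hφ n).memLp_gradient 2) h1
  have hb := tendsto_integral_inner hw huq (fun n => (hφ n).memLp _) h2
  have hi := integrable_inner_of_holderConjugate hw huq
  have hinner (a b : ℝ) : ⟪a, b⟫ = a * b := by simp [mul_comm]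
  simp only [hinner] at hb hi
  simp only [integral_inner_extremalGradient_gradient hN (hφ _)] at ha
  exact ⟨hi, tendsto_nhds_unique ha hb⟩

end Polar

/-! ### Translations, dilations and change of sign -/

section Affine

variable {N : ℕ} {u : EuclideanSpace ℝ (Fin N) → ℝ}
  {G : EuclideanSpace ℝ (Fin N) → EuclideanSpace ℝ (Fin N)}

theorem eLpNorm_comp_affine {F : Type*} [NormedAddCommGroup F]
    (f : EuclideanSpace ℝ (Fin N) → F) (p : ℝ≥0∞) (a : EuclideanSpace ℝ (Fin N)) {R : ℝ}
    (hR : 0 < R) :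
    eLpNorm (fun x => f (a + R • x)) p volume =
      ENNReal.ofReal (R ^ N)⁻¹ ^ (1 / p).toReal * eLpNorm f p volume := by
  have h1 : MeasurableEmbedding fun x : EuclideanSpace ℝ (Fin N) => R • x :=
    (Homeomorph.smulOfNeZero R hR.ne').measurableEmbedding
  have h2 : MeasurableEmbedding fun x : EuclideanSpace ℝ (Fin N) => a + x :=
    (Homeomorph.addLeft a).measurableEmbedding
  have e2 : eLpNorm (fun x => f (a + x)) p volume = eLpNorm f p volume := by
    have e := h2.eLpNorm_map_measure (g := f) (p := p) (μ := volume)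
    rw [map_add_left_eq_self] at e
    exact e.symm
  have e1 := h1.eLpNorm_map_measure (g := fun x => f (a + x)) (p := p) (μ := volume)
  rw [Measure.map_addHaar_smul _ hR.ne', finrank_euclideanSpace, Fintype.card_fin,
    abs_of_pos (by positivity), eLpNorm_smul_measure_of_ne_zero, e2, smul_eq_mul] at e1
  · exact e1.symm
  · simpa using pow_pos hR N

theorem IsTestFunction.comp_affine {φ : EuclideanSpace ℝ (Fin N) → ℝ} (hφ : IsTestFunction φ)
    (a : EuclideanSpace ℝ (Fin N)) {R : ℝ} (hR : 0 < R) :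
    IsTestFunction (fun x => R⁻¹ * φ (a + R • x)) ∧
      ∀ x, ∇ (fun x => R⁻¹ * φ (a + R • x)) x = ∇ φ (a + R • x) := by
  refine ⟨⟨?_, ?_⟩, fun x => ?_⟩
  · exact contDiff_const.mul
      (hφ.1.comp (contDiff_const.add (contDiff_id.const_smul R)))
  · have h := hφ.2.comp_homeomorph
      ((Homeomorph.smulOfNeZero R hR.ne').trans (Homeomorph.addLeft a))
    exact h.mul_left
  · have h1 : HasFDerivAt (fun x : EuclideanSpace ℝ (Fin N) => a + R • x)
        (R • ContinuousLinearMap.id ℝ (EuclideanSpace ℝ (Fin N))) x :=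
      ((hasFDerivAt_id x).const_smul R).const_add a
    have h2 := ((hφ.differentiable (a + R • x)).hasFDerivAt.comp x h1).const_mul R⁻¹
    refine (HasFDerivAt.hasGradientAt_of_inner (u := fun x => R⁻¹ * φ (a + R • x)) h2
      fun v => ?_).gradient
    rw [inner_gradient_left]
    simp
    field_simp

/-- The factor `R⁻¹` compensates the chain rule, so gradients are only transported and the bound on
them is unchanged. -/
theorem IsTestLimit.comp_affine (h : IsTestLimit u G) (a : EuclideanSpace ℝ (Fin N)) {R : ℝ}
    (hR : 0 < R) : IsTestLimit (fun x => R⁻¹ * u (a + R • x)) (fun x => G (a + R • x)) := by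
  obtain ⟨φ, hφ, h1, h2⟩ := h
  refine ⟨fun n x => R⁻¹ * φ n (a + R • x), fun n => ((hφ n).comp_affine a hR).1, ?_, ?_⟩
  · have e (n : ℕ) : eLpNorm (fun x => ∇ (fun x => R⁻¹ * φ n (a + R • x)) x - G (a + R • x)) 2
        volume = ENNReal.ofReal (R ^ N)⁻¹ ^ (1 / 2 : ℝ≥0∞).toReal *
          eLpNorm (fun x => ∇ (φ n) x - G x) 2 volume := by
      rw [← eLpNorm_comp_affine (fun x => ∇ (φ n) x - G x) _ a hR]
      congr 1
      ext1 x
      rw [((hφ n).comp_affine a hR).2]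
    simp_rw [e]
    have := ENNReal.Tendsto.const_mul h1 (a := ENNReal.ofReal (R ^ N)⁻¹ ^ (1 / 2 : ℝ≥0∞).toReal)
      (.inr (ENNReal.rpow_ne_top_of_nonneg ENNReal.toReal_nonneg ENNReal.ofReal_ne_top))
    rwa [mul_zero] at this
  · have e (n : ℕ) : eLpNorm (fun x => R⁻¹ * φ n (a + R • x) - R⁻¹ * u (a + R • x))
        (sobolevExponent N) volume = ‖R⁻¹‖ₑ * (ENNReal.ofReal (R ^ N)⁻¹ ^
          (1 / sobolevExponent N).toReal *
            eLpNorm (fun x => φ n x - u x) (sobolevExponent N) volume) := by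
      rw [← eLpNorm_comp_affine (fun x => φ n x - u x) _ a hR, ← eLpNorm_const_smul]
      congr 1
      ext1 x
      simp [mul_sub]
    simp_rw [e]
    have h3 := ENNReal.Tendsto.const_mul h2
      (a := ENNReal.ofReal (R ^ N)⁻¹ ^ (1 / sobolevExponent N).toReal)
      (.inr (ENNReal.rpow_ne_top_of_nonneg ENNReal.toReal_nonneg ENNReal.ofReal_ne_top))
    have h4 := ENNReal.Tendsto.const_mul h3 (a := ‖R⁻¹‖ₑ) (.inr enorm_ne_top)
    rwa [mul_zero, mul_zero] at h4

theorem gradient_neg (x : EuclideanSpace ℝ (Fin N)) : ∇ (fun y => -u y) x = -∇ u x := by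
  rw [gradient, gradient, fderiv_fun_neg, map_neg]

theorem IsTestFunction.neg {φ : EuclideanSpace ℝ (Fin N) → ℝ} (hφ : IsTestFunction φ) :
    IsTestFunction fun x => -φ x :=
  ⟨hφ.1.neg, hφ.2.neg⟩

theorem IsTestLimit.neg (h : IsTestLimit u G) : IsTestLimit (fun x => -u x) (fun x => -G x) := by
  obtain ⟨φ, hφ, h1, h2⟩ := h
  refine ⟨fun n x => -φ n x, fun n => (hφ n).neg, ?_, ?_⟩
  · refine h1.congr fun n => ?_
    rw [← eLpNorm_neg]
    congr 1
    ext1 x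
    simp [gradient_neg, add_comm, sub_eq_add_neg]
  · refine h2.congr fun n => ?_
    rw [← eLpNorm_neg]
    congr 1
    ext1 x
    simp [add_comm, sub_eq_add_neg]

end Affine

/-! ### Minimality and the sharp constant -/

section Minimality

variable {N : ℕ} {u : EuclideanSpace ℝ (Fin N) → ℝ}
  {G : EuclideanSpace ℝ (Fin N) → EuclideanSpace ℝ (Fin N)}

theorem inner_toLp_toLp {F G : EuclideanSpace ℝ (Fin N) → EuclideanSpace ℝ (Fin N)}
    (hF : MemLp F 2 volume) (hG : MemLp G 2 volume) :
    ⟪hF.toLp F, hG.toLp G⟫ = ∫ x, ⟪F x, G x⟫ := by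
  rw [L2.inner_def]
  refine integral_congr_ae ?_
  filter_upwards [hF.coeFn_toLp, hG.coeFn_toLp] with x h1 h2
  rw [h1, h2]

/-- Among the `1`-Lipschitz limits of test functions with height `peak N` at the origin, the
extremal function has the least Dirichlet energy. -/
theorem IsTestLimit.eLpNorm_extremalGradient_le (hN : 3 ≤ N) (h : IsTestLimit u G)
    (hG : MemLp G 2 volume) (hu : LipschitzWith 1 u) (h0 : u 0 = peak N) :
    eLpNorm (extremalGradient N) 2 volume ≤ eLpNorm G 2 volume := by
  have hV := memLp_extremalGradient hN
  obtain ⟨i1, e1⟩ := h.integral_inner_extremalGradient hN hu.continuous.aestronglyMeasurable hG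
  obtain ⟨i2, e2⟩ := (isTestLimit_extremal hN).integral_inner_extremalGradient hN
    lipschitzWith_extremal.continuous.aestronglyMeasurable
    ((memLp_congr_ae (gradient_extremal_ae_eq hN)).2 hV)
  have e3 : ∫ x, ⟪extremalGradient N x, ∇ (extremal N) x⟫ =
      ∫ x, ⟪extremalGradient N x, extremalGradient N x⟫ := by
    refine integral_congr_ae ?_
    filter_upwards [gradient_extremal_ae_eq hN] with x hx
    rw [hx]
  -- The weight lives on the unit ball, where the extremal function is the cone `u 0 - |x|`, the
  -- lowest graph a 1-Lipschitz function with this height at the origin can have.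
  have hle : ∫ x, laplaceWeight N x * extremal N x ≤ ∫ x, laplaceWeight N x * u x := by
    refine integral_mono i2 i1 fun x => ?_
    by_cases hx : ‖x‖ ≤ 1
    · refine mul_le_mul_of_nonneg_left ?_ (laplaceWeight_nonneg hN x)
      rw [extremal, profile_of_le_one hx, ← h0]
      have := hu.dist_le_mul 0 x
      rw [dist_zero_left, Real.dist_eq, NNReal.coe_one, one_mul] at this
      linarith [le_abs_self (u 0 - u x)]
    · simp [laplaceWeight, hx]
  rw [← e1, ← e2, e3, ← inner_toLp_toLp hV hV, ← inner_toLp_toLp hV hG,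
    real_inner_self_eq_norm_sq] at hle
  have h4 := hle.trans (real_inner_le_norm _ _)
  -- Cauchy–Schwarz has given `‖V‖² ≤ ‖V‖ ‖G‖`; arguing by contradiction avoids dividing by a norm
  -- that might vanish.
  have h5 : ‖hV.toLp‖ ≤ ‖hG.toLp‖ := by
    by_contra! hlt
    nlinarith [norm_nonneg hG.toLp]
  rw [Lp.norm_toLp, Lp.norm_toLp] at h5
  exact (ENNReal.toReal_le_toReal hV.2.ne hG.2.ne).1 h5

theorem IsTestLimit.ofReal_pow_mul_le (hN : 3 ≤ N) (h : IsTestLimit u G)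
    (hG : MemLp G 2 volume) (hu : LipschitzWith 1 u) {a : EuclideanSpace ℝ (Fin N)}
    (ha : 0 < u a) :
    ENNReal.ofReal (u a / peak N) ^ N * eLpNorm (extremalGradient N) 2 volume ^ 2 ≤
      eLpNorm G 2 volume ^ 2 := by
  have hp : 0 < peak N := zero_lt_one.trans (one_lt_peak hN)
  set R := u a / peak N with hRdef
  have hR : 0 < R := by positivity
  have hGa : MemLp (fun x => G (a + R • x)) 2 volume := by
    refine ⟨?_, ?_⟩
    · have hq : Measure.QuasiMeasurePreserving
          (fun x : EuclideanSpace ℝ (Fin N) => a + R • x) volume volume := by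
        refine (measurePreserving_add_left volume a).quasiMeasurePreserving.comp
          ⟨measurable_const_smul R, ?_⟩
        rw [Measure.map_addHaar_smul _ hR.ne']
        exact Measure.smul_absolutelyContinuous
      exact hG.1.comp_quasiMeasurePreserving hq
    · rw [eLpNorm_comp_affine G 2 a hR]
      exact ENNReal.mul_lt_top
        (ENNReal.rpow_lt_top_of_nonneg ENNReal.toReal_nonneg ENNReal.ofReal_ne_top) hG.2
  have hlip : LipschitzWith 1 fun x => R⁻¹ * u (a + R • x) := by
    refine LipschitzWith.of_dist_le_mul fun x y => ?_
    have h1 := hu.dist_le_mul (a + R • x) (a + R • y)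
    rw [dist_add_left, dist_smul₀, Real.norm_of_nonneg hR.le, NNReal.coe_one, one_mul] at h1
    rw [Real.dist_eq, ← mul_sub, abs_mul, abs_of_pos (inv_pos.2 hR), ← Real.dist_eq, NNReal.coe_one,
      one_mul, inv_mul_le_iff₀ hR]
    exact h1
  have key := (h.comp_affine a hR).eLpNorm_extremalGradient_le hN hGa hlip (by
    simp only [smul_zero, add_zero]
    rw [hRdef]
    field_simp)
  rw [eLpNorm_comp_affine G 2 a hR] at key
  have h2 := pow_le_pow_left' key 2
  -- Squaring turns the `L²` scaling factor `((R^N)⁻¹)^(1/2)` into `(R^N)⁻¹`.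
  rw [mul_pow, ← ENNReal.rpow_natCast (ENNReal.ofReal (R ^ N)⁻¹ ^ _), ← ENNReal.rpow_mul] at h2
  have h3 : (1 / 2 : ℝ≥0∞).toReal * ((2 : ℕ) : ℝ) = 1 := by simp
  rw [h3, ENNReal.rpow_one, ENNReal.ofReal_inv_of_pos (by positivity),
    ENNReal.ofReal_pow hR.le] at h2
  rw [mul_comm]
  refine (mul_le_mul_left h2 _).trans ?_
  rw [mul_right_comm, ENNReal.inv_mul_cancel, one_mul]
  · simpa using fun h => absurd h (not_le.2 hR)
  · exact ENNReal.pow_ne_top ENNReal.ofReal_ne_top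

/-- Uniqueness of weak gradients replaces the abstract `G` by `∇ u`. Mollification improves the
unspecified Lipschitz constant to `1`. -/
theorem isTestLimit_gradient_of_mem_spaceX (hu : u ∈ spaceX N) :
    IsTestLimit u (∇ u) ∧ MemLp (∇ u) 2 volume ∧ LipschitzWith 1 u := by
  obtain ⟨⟨G, hw, hG, φ, hφ, h1, h2⟩, ⟨K, hK⟩, hle⟩ := hu
  have hae : G =ᵐ[volume] ∇ u := hw.ae_eq hK.hasWeakGradient
  refine ⟨⟨φ, hφ, h1.congr fun n => eLpNorm_congr_ae ?_, h2⟩, (memLp_congr_ae hae).1 hG,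
    hK.hasWeakGradient.lipschitzWith hK.continuous (by simpa using hle)⟩
  filter_upwards [hae] with x hx
  rw [hx]

/-- The optimal constant, as the quotient of the extremal function. -/
noncomputable def extremalConstant (N : ℕ) : ℝ≥0∞ :=
  eLpNorm (extremalGradient N) 2 volume ^ 2 / ENNReal.ofReal (peak N) ^ N

theorem extremalConstant_ne_top (hN : 3 ≤ N) : extremalConstant N ≠ ⊤ := by
  have hp : 0 < peak N := zero_lt_one.trans (one_lt_peak hN)
  refine ENNReal.div_ne_top (ENNReal.pow_ne_top (memLp_extremalGradient hN).2.ne) ?_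
  exact pow_ne_zero _ (by simpa using hp)

theorem extremalConstant_ne_zero (hN : 3 ≤ N) : extremalConstant N ≠ 0 := by
  refine (ENNReal.div_pos (pow_ne_zero _ fun h => ?_)
    (ENNReal.pow_ne_top ENNReal.ofReal_ne_top)).ne'
  rw [eLpNorm_eq_zero_iff (memLp_extremalGradient hN).1 (by simp)] at h
  obtain ⟨x, hx, hx0⟩ := (h.and (ae_ne_zero hN)).exists
  have h1 := norm_extremalGradient hx0
  rw [hx] at h1
  simp only [Pi.zero_apply, norm_zero] at h1
  exact (profileSlope_pos ‖x‖).ne h1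

theorem extremalConstant_mul_enorm_pow_le (hN : 3 ≤ N) (hu : u ∈ spaceX N)
    (a : EuclideanSpace ℝ (Fin N)) :
    extremalConstant N * ‖u a‖ₑ ^ N ≤ eLpNorm (∇ u) 2 volume ^ 2 := by
  have hp : 0 < peak N := zero_lt_one.trans (one_lt_peak hN)
  obtain ⟨hl, hG, hlip⟩ := isTestLimit_gradient_of_mem_spaceX hu
  have key : ENNReal.ofReal (|u a| / peak N) ^ N * eLpNorm (extremalGradient N) 2 volume ^ 2 ≤
      eLpNorm (∇ u) 2 volume ^ 2 := by
    rcases lt_trichotomy (u a) 0 with h | h | h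
    · rw [abs_of_neg h]
      have h1 := hl.neg.ofReal_pow_mul_le hN hG.neg hlip.neg (a := a) (neg_pos.2 h)
      have h2 : eLpNorm (fun x => -∇ u x) 2 volume = eLpNorm (∇ u) 2 volume := eLpNorm_neg _ _ _
      rwa [h2] at h1
    · simp [h, show N ≠ 0 by omega]
    · rw [abs_of_pos h]
      exact hl.ofReal_pow_mul_le hN hG hlip h
  refine le_trans (le_of_eq ?_) key
  rw [ENNReal.ofReal_div_of_pos hp, ← Real.enorm_eq_ofReal_abs, extremalConstant, div_eq_mul_inv,
    div_eq_mul_inv, mul_pow, ENNReal.inv_pow]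
  ring

theorem extremalConstant_mul_eLpNorm_pow_le (hN : 3 ≤ N) (hu : u ∈ spaceX N) :
    extremalConstant N * eLpNorm u ⊤ volume ^ N ≤ eLpNorm (∇ u) 2 volume ^ 2 := by
  have h0 := extremalConstant_ne_zero hN
  have ht := extremalConstant_ne_top hN
  have hN0 : (N : ℝ) ≠ 0 := by
    have : N ≠ 0 := by omega
    exact_mod_cast this
  -- Isolating the essential supremum, by division and an `N`-th root, lets the pointwise bound pass
  -- to it without assuming that it is finite or attained.
  rw [mul_comm, ← ENNReal.le_div_iff_mul_le (.inl h0) (.inl ht), ← ENNReal.rpow_natCast,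
    ← ENNReal.le_rpow_inv_iff (by positivity), eLpNorm_exponent_top]
  refine eLpNormEssSup_le_of_ae_enorm_bound (.of_forall fun a => ?_)
  rw [ENNReal.le_rpow_inv_iff (by positivity), ENNReal.rpow_natCast,
    ENNReal.le_div_iff_mul_le (.inl h0) (.inl ht), mul_comm]
  exact extremalConstant_mul_enorm_pow_le hN hu a

/-- The bound holds almost everywhere, hence on a dense set, and by continuity it defines a closed
one. -/
theorem Continuous.enorm_le_eLpNorm_top (hu : Continuous u) (a : EuclideanSpace ℝ (Fin N)) :
    ‖u a‖ₑ ≤ eLpNorm u ⊤ volume := by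
  have hd := Measure.dense_of_ae (ae_le_eLpNormEssSup (f := u) (μ := volume))
  have hc : IsClosed {x | ‖u x‖ₑ ≤ eLpNormEssSup u volume} :=
    isClosed_le hu.enorm continuous_const
  have := hc.closure_eq ▸ hd.closure_eq
  have ha : a ∈ {x | ‖u x‖ₑ ≤ eLpNormEssSup u volume} := this ▸ Set.mem_univ a
  simpa using ha

/-- Only the lower bound `peak N = U 0 ≤ ‖U‖_∞` on the denominator is needed. -/
theorem ratioR_extremal_le (hN : 3 ≤ N) : ratioR (extremal N) ≤ extremalConstant N := by
  have hp : 0 < peak N := zero_lt_one.trans (one_lt_peak hN)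
  rw [ratioR, extremalConstant, eLpNorm_congr_ae (gradient_extremal_ae_eq hN)]
  gcongr
  have h := lipschitzWith_extremal.continuous.enorm_le_eLpNorm_top (u := extremal N) 0
  rwa [extremal, norm_zero, profile_zero, Real.enorm_eq_ofReal hp.le] at h

theorem extremalConstant_le_ratioR (hN : 3 ≤ N) (hu : u ∈ spaceX N \ {0}) :
    extremalConstant N ≤ ratioR u := by
  obtain ⟨-, hG, hlip⟩ := isTestLimit_gradient_of_mem_spaceX hu.1
  have h0 : eLpNorm u ⊤ volume ≠ 0 := by
    intro h
    refine hu.2 (funext fun a => ?_)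
    simpa [h] using hlip.continuous.enorm_le_eLpNorm_top a
  rw [ratioR, ENNReal.le_div_iff_mul_le (.inl (pow_ne_zero _ h0))
    (.inr (ENNReal.pow_ne_top hG.2.ne))]
  exact extremalConstant_mul_eLpNorm_pow_le hN hu.1

theorem extremal_ne_zero (hN : 3 ≤ N) : extremal N ≠ 0 := fun h => by
  have := congrFun h 0
  exact (profile_pos hN _).ne' this

end Minimality

theorem lemma3p4 (N : ℕ) (hN : 3 ≤ N) :
    (∃ C : ℝ, 0 < C ∧ ∀ u ∈ spaceX N,
      ENNReal.ofReal C * eLpNorm u ∞ volume ^ N ≤ eLpNorm (∇ u) 2 volume ^ 2) ∧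
    ∃ u ∈ spaceX N \ {0}, IsRadialDecreasing u ∧ ratioR u = bestConstant N := by
  refine ⟨⟨(extremalConstant N).toReal, ENNReal.toReal_pos (extremalConstant_ne_zero hN)
    (extremalConstant_ne_top hN), fun u hu => ?_⟩, extremal N,
    ⟨extremal_mem_spaceX hN, extremal_ne_zero hN⟩,
    ⟨profile N, strictAnti_profile.strictAntiOn _, fun x => rfl⟩, le_antisymm ?_ ?_⟩
  · rw [ENNReal.ofReal_toReal (extremalConstant_ne_top hN)]
    exact extremalConstant_mul_eLpNorm_pow_le hN hu
  · exact (ratioR_extremal_le hN).trans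
      (le_iInf₂ fun u hu => extremalConstant_le_ratioR hN hu)
  · exact iInf₂_le _ ⟨extremal_mem_spaceX hN, extremal_ne_zero hN⟩
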